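/- Let $n\ge 1$ and write $S_n$ for the set of permutations of $[n]=\{1,\dots,n\}$. For $\sigma\in S_n$: - a weak exceedance of $\sigma$ is an index $j\in[n]$ with $\sigma(j)\ge j$; - the number of crossings of $\sigma$ is $\sum_{i=1}^n\bigl(|\{j: j<i\le\sigma(j)<\sigma(i)\}|+|\{j: j>i>\sigma(j)>\sigma(i)\}|\bigr)$; - the number of nestings of $\sigma$ is $\sum_{i=1}^n\bigl(|\{j: j<i\le\sigma(i)<\sigma(j)\}|+|\{j: j>i>\sigma(i)>\sigma(j)\}|\bigr)$; - a descent of $\sigma$ is an index $1\le i<n$ with $\sigma(i)>\sigma(i+1)$; - an occurrence of the pattern $13\text{-}2$ in $\sigma$ is a pair $1\le i<j\le n$ with $\sigma(i)<\sigma(j)<\sigma(i+1)$; - an occurrence of the pattern $2\text{-}13$ in $\sigma$ is a pair $1\le i<j<n$ with $\sigma(j)<\sigma(i)<\sigma(j+1)$. Then there is a bijection $\Phi:S_n\to S_n$ which, for all integers $k,\ell,m\ge 0$, restricts to a bijection from the set of permutations of $[n]$ with $k$ weak exceedances, $\ell$ crossings and $m$ nestings onto the set of permutations of $[n]$ with $k-1$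 descents, $\ell$ occurrences of the pattern $13\text{-}2$ and $m$ occurrences of the pattern $2\text{-}13$. -/

import Mathlib

/- Permutations of `[n] = {1, …, n}` are modelled as `Equiv.Perm (Fin n)`, both positions and values
being shifted by one; every statistic below only compares positions and values with each other. -/

namespace PermStat

/-- The number of weak exceedances: positions `j` with `σ(j) ≥ j`. -/
def wex {n : ℕ} (σ : Equiv.Perm (Fin n)) : ℕ :=
  (Finset.univ.filter fun j : Fin n => j ≤ σ j).card

/-- `C₊(i) = {j | j < i ≤ σ(j) < σ(i)}`. -/
def crossPlusAt {n : ℕ} (σ : Equiv.Perm (Fin n)) (i : Fin n) : Finset (Fin n) :=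
  Finset.univ.filter fun j : Fin n => j < i ∧ i ≤ σ j ∧ σ j < σ i

/-- `C₋(i) = {j | j > i > σ(j) > σ(i)}`. -/
def crossMinusAt {n : ℕ} (σ : Equiv.Perm (Fin n)) (i : Fin n) : Finset (Fin n) :=
  Finset.univ.filter fun j : Fin n => i < j ∧ σ j < i ∧ σ i < σ j

/-- The number of crossings, `C₊(σ) + C₋(σ)`. -/
def crossings {n : ℕ} (σ : Equiv.Perm (Fin n)) : ℕ :=
  (∑ i : Fin n, (crossPlusAt σ i).card) + ∑ i : Fin n, (crossMinusAt σ i).card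

/-- `A₊(i) = {j | j < i ≤ σ(i) < σ(j)}`. -/
def nestPlusAt {n : ℕ} (σ : Equiv.Perm (Fin n)) (i : Fin n) : Finset (Fin n) :=
  Finset.univ.filter fun j : Fin n => j < i ∧ i ≤ σ i ∧ σ i < σ j

/-- `A₋(i) = {j | j > i > σ(i) > σ(j)}`. -/
def nestMinusAt {n : ℕ} (σ : Equiv.Perm (Fin n)) (i : Fin n) : Finset (Fin n) :=
  Finset.univ.filter fun j : Fin n => i < j ∧ σ i < i ∧ σ j < σ i

/-- The number of nestings, `A₊(σ) + A₋(σ)`. -/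
def nestings {n : ℕ} (σ : Equiv.Perm (Fin n)) : ℕ :=
  (∑ i : Fin n, (nestPlusAt σ i).card) + ∑ i : Fin n, (nestMinusAt σ i).card

/-- The number of descents: positions `i` such that `i + 1` is a position and `σ(i) > σ(i+1)`. -/
def descents {n : ℕ} (σ : Equiv.Perm (Fin n)) : ℕ :=
  (Finset.univ.filter fun i : Fin n =>
    ∃ h : i.val + 1 < n, σ ⟨i.val + 1, h⟩ < σ i).card

/-- The number of occurrences of the pattern `13-2`: pairs of positions `i < j`
with `σ(i) < σ(j) < σ(i+1)`. -/
def occ13_2 {n : ℕ} (σ : Equiv.Perm (Fin n)) : ℕ :=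
  (Finset.univ.filter fun x : Fin n × Fin n =>
    x.1 < x.2 ∧ ∃ h : x.1.val + 1 < n, σ x.1 < σ x.2 ∧ σ x.2 < σ ⟨x.1.val + 1, h⟩).card

/-- The number of occurrences of the pattern `2-13`: pairs of positions `i < j`
with `j + 1` a position and `σ(j) < σ(i) < σ(j+1)`. -/
def occ2_13 {n : ℕ} (σ : Equiv.Perm (Fin n)) : ℕ :=
  (Finset.univ.filter fun x : Fin n × Fin n =>
    x.1 < x.2 ∧ ∃ h : x.2.val + 1 < n, σ x.2 < σ x.1 ∧ σ x.1 < σ ⟨x.2.val + 1, h⟩).card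

end PermStat

/-! Both triples of statistics are read off one kind of object, the labelled histories of length `n`
from height 0 to 0. A step with flags `e`, `v` raises the height `h` by `e - v` and carries a label
`a < h + e`; the complementary label is `h + e - 1 - a`. `arcCode` scans the arc diagram of `σ` by
position. Steps with `v` count weak exceedances, labels sum to the crossings and complementary
labels to the nestings (`crossings_nestings_at`). `barCode` scans `π` by value. Steps with `v`
number one more than the descents, labels sum to the occurrences of `13-2` and complementary labels
to those of `2-13` (`patterns_at`). Both codes are injective (`arcCode_injective`,
`barCode_injective`), and there are at most `n!` histories (`card_hist_le`), so both are bijections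
onto histories. `Φ` is one followed by the inverse of the other; surjectivity is never proved by
building a permutation from a history. -/

namespace PermStat

open Finset

/-! ### Labelled histories and their number -/

/-- A letter `(e, v, a)` of a history: from height `h` it leads to height `h + e - v`, and its
label `a` is less than `h + e`. -/
abbrev Letter := Bool × Bool × ℕ

/-- The labelled histories of length `n` from height `0` to height `h`. -/
def hist : ℕ → ℕ → Finset (List Letter)
  | 0, h => if h = 0 then {[]} else ∅
  | n + 1, h =>
    ((((hist n h ×ˢ range (h + 1)).image fun x => x.1 ++ [(true, true, x.2)]) ∪
      ((hist n h ×ˢ range h).image fun x => x.1 ++ [(false, false, x.2)])) ∪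
      ((hist n (h + 1) ×ˢ range (h + 1)).image fun x => x.1 ++ [(false, true, x.2)])) ∪
      -- At `h = 0` the truncated `h - 1` is harmless, since `range 0` is empty.
      ((hist n (h - 1) ×ˢ range h).image fun x => x.1 ++ [(true, false, x.2)])

/-- The bound at every height `h` is what makes the induction on the last letter close: the four
kinds of last letter give a recurrence that `n! * n.choose h` satisfies exactly. -/
theorem card_hist_le (n h : ℕ) : (hist n h).card ≤ n.factorial * n.choose h := by
  induction n generalizing h with
  | zero => cases h <;> simp [hist]
  | succ n ih =>
    have key : (hist (n + 1) h).card ≤ (hist n h).card * (h + 1) + (hist n h).card * h +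
        (hist n (h + 1)).card * (h + 1) + (hist n (h - 1)).card * h := by
      rw [hist]
      refine (card_union_le _ _).trans (add_le_add ((card_union_le _ _).trans
        (add_le_add ((card_union_le _ _).trans (add_le_add ?_ ?_)) ?_)) ?_) <;>
      · refine card_image_le.trans ?_
        rw [card_product, card_range]
    have h1 := Nat.mul_le_mul_right (h + 1) (ih h)
    have h2 := Nat.mul_le_mul_right h (ih h)
    have h3 := Nat.mul_le_mul_right (h + 1) (ih (h + 1))
    have h4 := Nat.mul_le_mul_right h (ih (h - 1))
    refine key.trans ((add_le_add (add_le_add (add_le_add h1 h2) h3) h4).trans (le_of_eq ?_))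
    rw [Nat.factorial_succ]
    rcases h with _ | h
    · simp; ring
    · have e1 := Nat.add_one_mul_choose_eq n h
      have e2 := Nat.add_one_mul_choose_eq n (h + 1)
      rw [Nat.choose_succ_succ n (h + 1)] at e2
      rw [Nat.choose_succ_succ n h] at e1 ⊢
      simp only [Nat.add_sub_cancel, Nat.succ_eq_add_one] at *
      have e3 := e1.symm
      have e4 := e2.symm
      linear_combination n.factorial * e3 + n.factorial * e4

theorem mem_hist {c : ℕ → Letter} {H : ℕ → ℕ} {n : ℕ} (h0 : H 0 = 0)
    (hstep : ∀ i < n, H (i + 1) + (c i).2.1.toNat = H i + (c i).1.toNat)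
    (hlab : ∀ i < n, (c i).2.2 < H i + (c i).1.toNat) :
    (List.range n).map c ∈ hist n (H n) := by
  induction n with
  | zero => simp [hist, h0]
  | succ n ih =>
    have ih' := ih (fun i hi => hstep i (by omega)) (fun i hi => hlab i (by omega))
    have hs := hstep n (by omega)
    have hl := hlab n (by omega)
    rw [List.range_succ, List.map_append, hist]
    simp only [mem_union, mem_image, mem_product, mem_range, Prod.exists, List.map_cons,
      List.map_nil]
    rcases hc : c n with ⟨e, v, a⟩
    rw [hc] at hs hl
    rcases e with _ | _ <;> rcases v with _ | _ <;> simp only [Bool.toNat_true, Bool.toNat_false] at hs hl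
    · exact Or.inl (Or.inl (Or.inr ⟨_, a, ⟨by rwa [show H (n + 1) = H n by omega], by omega⟩, rfl⟩))
    · exact Or.inl (Or.inr ⟨_, a, ⟨by rwa [hs], by omega⟩, rfl⟩)
    · exact Or.inr ⟨_, a, ⟨by rwa [show H (n + 1) - 1 = H n by omega], by omega⟩, rfl⟩
    · exact Or.inl (Or.inl (Or.inl ⟨_, a, ⟨by rwa [show H (n + 1) = H n by omega], by omega⟩, rfl⟩))

/-- The word of a sequence of letters. -/
def word {n : ℕ} (c : Fin n → Letter) : List Letter :=
  (List.range n).map fun i => if h : i < n then c ⟨i, h⟩ else (true, true, 0)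

theorem word_injective {n : ℕ} : Function.Injective (word (n := n)) := by
  intro c d h
  funext i
  have := (List.map_inj_left.1 h) i.1 (List.mem_range.2 i.2)
  simpa using this

theorem word_mem_hist {n : ℕ} {c : Fin n → Letter} {H : ℕ → ℕ} (h0 : H 0 = 0) (hn : H n = 0)
    (hstep : ∀ i : Fin n, H (i + 1) + (c i).2.1.toNat = H i + (c i).1.toNat)
    (hlab : ∀ i : Fin n, (c i).2.2 < H i + (c i).1.toNat) : word c ∈ hist n 0 := by
  rw [← hn]
  refine mem_hist h0 (fun i hi => ?_) (fun i hi => ?_)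
  · simpa [hi] using hstep ⟨i, hi⟩
  · simpa [hi] using hlab ⟨i, hi⟩

/-- Equal codes thus have equal heights, hence equal complementary labels; this transfers nestings
to `2-13`. -/
theorem height_unique {n : ℕ} {c : Fin n → Letter} {H K : ℕ → ℕ} (h0 : H 0 = 0) (k0 : K 0 = 0)
    (hH : ∀ i : Fin n, H (i + 1) + (c i).2.1.toNat = H i + (c i).1.toNat)
    (hK : ∀ i : Fin n, K (i + 1) + (c i).2.1.toNat = K i + (c i).1.toNat) :
    ∀ i ≤ n, H i = K i := by
  intro i
  induction i with
  | zero => intro _; rw [h0, k0]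
  | succ i ih =>
    intro hi
    have a := hH ⟨i, hi⟩
    have b := hK ⟨i, hi⟩
    have := ih (by omega)
    simp only at a b
    omega

/-- Two injective encodings of permutations by histories have the same image. -/
theorem exists_equiv_of_injective {n : ℕ} {c d : Equiv.Perm (Fin n) → Fin n → Letter}
    (hc : Function.Injective c) (hd : Function.Injective d)
    (hc' : ∀ σ, word (c σ) ∈ hist n 0) (hd' : ∀ σ, word (d σ) ∈ hist n 0) :
    ∃ Φ : Equiv.Perm (Fin n) ≃ Equiv.Perm (Fin n), ∀ σ, d (Φ σ) = c σ := by
  have bij : ∀ f : Equiv.Perm (Fin n) → Fin n → Letter, Function.Injective f →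
      (hf' : ∀ σ, word (f σ) ∈ hist n 0) →
      Function.Bijective fun σ => (⟨word (f σ), hf' σ⟩ : hist n 0) := by
    intro f hf hf'
    rw [Fintype.bijective_iff_injective_and_card]
    have inj : Function.Injective fun σ => (⟨word (f σ), hf' σ⟩ : hist n 0) := fun σ τ h =>
      hf (word_injective (Subtype.ext_iff.1 h))
    refine ⟨inj, le_antisymm (Fintype.card_le_of_injective _ inj) ?_⟩
    rw [Fintype.card_perm, Fintype.card_fin, Fintype.card_coe]
    simpa using card_hist_le n 0
  refine ⟨(Equiv.ofBijective _ (bij c hc hc')).trans (Equiv.ofBijective _ (bij d hd hd')).symm,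
    fun σ => word_injective ?_⟩
  have := (Equiv.ofBijective _ (bij d hd hd')).apply_symm_apply (Equiv.ofBijective _ (bij c hc hc') σ)
  exact Subtype.ext_iff.1 this

/-! ### Weak exceedances, crossings and nestings -/

/-- The number of `j < i` with `σ j ≥ i`. -/
def arcHeight {n : ℕ} (σ : Equiv.Perm (Fin n)) (i : ℕ) : ℕ :=
  (univ.filter fun j : Fin n => j.1 < i ∧ i ≤ (σ j).1).card

/-- The crossing history of a permutation. -/
def arcCode {n : ℕ} (σ : Equiv.Perm (Fin n)) (i : Fin n) : Letter :=
  (decide (i ≤ σ i), decide (σ.symm i ≤ i), (crossPlusAt σ i).card + (crossMinusAt σ i).card)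

theorem arcHeight_zero {n : ℕ} (σ : Equiv.Perm (Fin n)) : arcHeight σ 0 = 0 := by
  simp [arcHeight]

theorem arcHeight_self {n : ℕ} (σ : Equiv.Perm (Fin n)) : arcHeight σ n = 0 := by
  simp [arcHeight]

theorem card_filter_eq_and {α : Type*} [Fintype α] [DecidableEq α] (a : α) (p : Prop)
    [Decidable p] : (univ.filter fun j : α => j = a ∧ p).card = (decide p).toNat := by
  by_cases hp : p <;> simp [hp, filter_eq']

theorem arcHeight_step {n : ℕ} (σ : Equiv.Perm (Fin n)) (i : Fin n) :
    arcHeight σ (i + 1) + (arcCode σ i).2.1.toNat = arcHeight σ i + (arcCode σ i).1.toNat := by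
  simp only [arcHeight, arcCode]
  rw [← card_filter_eq_and (σ.symm i), ← card_filter_eq_and i, ← card_union_of_disjoint,
    ← card_union_of_disjoint]
  · congr 1
    ext j
    have h1 : j = σ.symm i ↔ σ j = i := by rw [Equiv.eq_symm_apply]
    simp only [mem_union, mem_filter, mem_univ, true_and]
    constructor
    · rintro (h | ⟨h, h'⟩)
      · by_cases hj : j = i
        · subst hj; right; exact ⟨rfl, Fin.le_def.2 (by omega)⟩
        · have := Fin.val_ne_of_ne hj; left; omega
      · rw [← h] at h'
        have h2 := h1.1 h
        by_cases hj : j = i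
        · right; refine ⟨hj, ?_⟩; rw [← hj, h2, hj]
        · have := Fin.val_ne_of_ne hj; rw [Fin.le_def] at h'; left; rw [h2]; omega
    · rintro (h | ⟨h, h'⟩)
      · by_cases hj : σ j = i
        · right; rw [← h1.2 hj]; exact ⟨rfl, Fin.le_def.2 (by omega)⟩
        · have := Fin.val_ne_of_ne hj; left; omega
      · subst h
        by_cases hj : σ j = j
        · right; rw [← h1.2 hj]; exact ⟨rfl, le_rfl⟩
        · have := Fin.val_ne_of_ne hj; rw [Fin.le_def] at h'; left; omega
  · rw [disjoint_filter]
    rintro j - h ⟨rfl, -⟩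
    omega
  · rw [disjoint_filter]
    rintro j - h ⟨rfl, -⟩
    simp at h

/-- As many arcs go up over a gap as go down, because `σ` is a bijection. This lets one height serve
both halves of the arc diagram. -/
theorem arcHeight_eq {n : ℕ} (σ : Equiv.Perm (Fin n)) (i : ℕ) :
    arcHeight σ i = (univ.filter fun j : Fin n => i ≤ j.1 ∧ (σ j).1 < i).card := by
  have h1 : (univ.filter fun j : Fin n => (σ j).1 < i).card =
      (univ.filter fun j : Fin n => j.1 < i).card := by
    refine card_bij' (fun j _ => σ j) (fun j _ => σ.symm j) ?_ ?_ ?_ ?_ <;> simp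
  have h2 := card_filter_add_card_filter_not (s := univ.filter fun j : Fin n => (σ j).1 < i)
    (fun j => j.1 < i)
  have h3 := card_filter_add_card_filter_not (s := univ.filter fun j : Fin n => j.1 < i)
    (fun j => (σ j).1 < i)
  simp only [filter_filter, not_lt] at h2 h3
  simp only [arcHeight]
  simp only [and_comm] at *
  omega

/-- For a weak exceedance `i`, each upper arc counted by the height either crosses or nests with the
arc of `i`. Otherwise the lower arcs do, but the arc of `i` is itself among those counted, which
accounts for the `+ 1`. -/
theorem crossings_nestings_at {n : ℕ} (σ : Equiv.Perm (Fin n)) (i : Fin n) :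
    (arcCode σ i).2.2 + ((nestPlusAt σ i).card + (nestMinusAt σ i).card) + 1 =
      arcHeight σ i + (arcCode σ i).1.toNat := by
  simp only [arcCode, crossPlusAt, crossMinusAt, nestPlusAt, nestMinusAt]
  by_cases hi : i ≤ σ i
  · have e1 : (univ.filter fun j => i < j ∧ σ j < i ∧ σ i < σ j) = ∅ := by
      refine filter_eq_empty_iff.2 fun j _ h => ?_
      simp only [Fin.lt_def, Fin.le_def] at *; omega
    have e2 : (univ.filter fun j => i < j ∧ σ i < i ∧ σ j < σ i) = ∅ := by
      refine filter_eq_empty_iff.2 fun j _ h => ?_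
      simp only [Fin.lt_def, Fin.le_def] at *; omega
    rw [e1, e2, arcHeight, card_empty, add_zero, add_zero, ← card_union_of_disjoint]
    · simp only [hi, decide_true, Bool.toNat_true]
      congr 2
      ext j
      simp only [mem_union, mem_filter, mem_univ, true_and]
      have : j.1 ≠ i.1 → (σ j).1 ≠ (σ i).1 := fun h h' =>
        h (congrArg Fin.val (σ.injective (Fin.ext h')))
      simp only [Fin.lt_def, Fin.le_def] at *; omega
    · rw [disjoint_filter]
      intro j _ h
      simp only [Fin.lt_def, Fin.le_def] at *; omega
  · have e1 : (univ.filter fun j => j < i ∧ i ≤ σ j ∧ σ j < σ i) = ∅ := by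
      refine filter_eq_empty_iff.2 fun j _ h => ?_
      simp only [Fin.lt_def, Fin.le_def] at *; omega
    have e2 : (univ.filter fun j => j < i ∧ i ≤ σ i ∧ σ i < σ j) = ∅ := by
      refine filter_eq_empty_iff.2 fun j _ h => ?_
      simp only [Fin.lt_def, Fin.le_def] at *; omega
    rw [e1, e2, arcHeight_eq, card_empty, zero_add, zero_add, ← card_union_of_disjoint,
      ← card_singleton i, ← card_union_of_disjoint]
    · simp only [hi, decide_false, Bool.toNat_false, add_zero]
      congr 1
      ext j
      simp only [mem_union, mem_filter, mem_univ, true_and, mem_singleton]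
      have h1 : j.1 ≠ i.1 → (σ j).1 ≠ (σ i).1 := fun h h' =>
        h (congrArg Fin.val (σ.injective (Fin.ext h')))
      have h2 : j.1 = i.1 → (σ j).1 = (σ i).1 := fun h => by rw [Fin.ext h]
      simp only [Fin.lt_def, Fin.le_def, Fin.ext_iff] at *; omega
    · simp
    · rw [disjoint_filter]
      intro j _ h
      simp only [Fin.lt_def, Fin.le_def] at *; omega

theorem arcCode_mem {n : ℕ} (σ : Equiv.Perm (Fin n)) : word (arcCode σ) ∈ hist n 0 :=
  word_mem_hist (arcHeight_zero σ) (arcHeight_self σ) (arcHeight_step σ) fun i => by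
    have := crossings_nestings_at σ i
    omega

theorem wex_eq {n : ℕ} (σ : Equiv.Perm (Fin n)) :
    wex σ = (univ.filter fun i => (arcCode σ i).2.1 = true).card := by
  refine card_bij' (fun j _ => σ j) (fun j _ => σ.symm j) ?_ ?_ ?_ ?_ <;> simp [arcCode]

/-! ### Recovering a permutation from its crossing history -/

/-- In a linear order, an element of a finite set is determined by the number of smaller elements
of the set. -/
theorem eq_of_card_filter_lt_eq {α : Type*} [LinearOrder α] {S : Finset α} {a b : α}
    (ha : a ∈ S) (hb : b ∈ S)
    (h : (S.filter fun x => x < a).card = (S.filter fun x => x < b).card) : a = b := by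
  have key : ∀ a b : α, a ∈ S → a < b →
      (S.filter fun x => x < a).card < (S.filter fun x => x < b).card := by
    intro a b ha hab
    refine card_lt_card ⟨fun x hx => ?_, fun hs => ?_⟩
    · rw [mem_filter] at *
      exact ⟨hx.1, hx.2.trans hab⟩
    · exact lt_irrefl a (mem_filter.1 (hs (mem_filter.2 ⟨ha, hab⟩))).2
  rcases lt_trichotomy a b with hab | hab | hab
  · have := key a b ha hab; omega
  · exact hab
  · have := key b a hb hab; omega

theorem arcCode_injective {n : ℕ} : Function.Injective (arcCode (n := n)) := by
  intro σ τ hst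
  have hE : ∀ i, i ≤ σ i ↔ i ≤ τ i := fun i => by
    simpa [arcCode] using congrArg Prod.fst (congrFun hst i)
  have hV : ∀ i, σ.symm i ≤ i ↔ τ.symm i ≤ i := fun i => by
    simpa [arcCode] using congrArg (fun x : Letter => x.2.1) (congrFun hst i)
  have hA : ∀ i, (crossPlusAt σ i).card + (crossMinusAt σ i).card =
      (crossPlusAt τ i).card + (crossMinusAt τ i).card := fun i =>
    congrArg (fun x : Letter => x.2.2) (congrFun hst i)
  have minus_empty : ∀ (ρ : Equiv.Perm (Fin n)) (i : Fin n), i ≤ ρ i → (crossMinusAt ρ i).card = 0 := by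
    intro ρ i hi
    refine card_eq_zero.2 (filter_eq_empty_iff.2 fun j _ h => ?_)
    exact absurd (h.2.2.trans h.2.1) (not_lt.2 hi)
  have plus_empty : ∀ (ρ : Equiv.Perm (Fin n)) (i : Fin n), ρ i < i → (crossPlusAt ρ i).card = 0 := by
    intro ρ i hi
    refine card_eq_zero.2 (filter_eq_empty_iff.2 fun j _ h => ?_)
    exact absurd (h.2.1.trans_lt h.2.2) (not_lt.2 hi.le)
  have plus_card : ∀ (ρ : Equiv.Perm (Fin n)) (i : Fin n), (crossPlusAt ρ i).card =
      ((univ.filter fun v => i ≤ v ∧ ρ.symm v ≤ i).filter fun v => v < ρ i).card := by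
    intro ρ i
    refine card_bij' (fun j _ => ρ j) (fun j _ => ρ.symm j) ?_ ?_ ?_ ?_
    · intro j hj
      simp only [crossPlusAt, mem_filter, mem_univ, true_and, Equiv.symm_apply_apply] at *
      exact ⟨⟨hj.2.1, hj.1.le⟩, hj.2.2⟩
    · intro j hj
      simp only [crossPlusAt, mem_filter, mem_univ, true_and, Equiv.apply_symm_apply] at *
      refine ⟨lt_of_le_of_ne hj.1.2 ?_, hj.1.1, hj.2⟩
      rintro rfl
      simp at hj
    · simp
    · simp
  have minus_card : ∀ (ρ : Equiv.Perm (Fin n)) (i : Fin n), (crossMinusAt ρ i).card =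
      ((univ.filter fun v : (Fin n)ᵒᵈ => OrderDual.ofDual v < i ∧ i ≤ ρ.symm (OrderDual.ofDual v)).filter
        fun v => v < OrderDual.toDual (ρ i)).card := by
    intro ρ i
    refine card_bij' (fun j _ => OrderDual.toDual (ρ j)) (fun j _ => ρ.symm (OrderDual.ofDual j)) ?_ ?_ ?_ ?_
    · intro j hj
      simp only [crossMinusAt, mem_filter, mem_univ, true_and, Equiv.symm_apply_apply,
        OrderDual.ofDual_toDual, OrderDual.toDual_lt_toDual] at *
      exact ⟨⟨hj.2.1, hj.1.le⟩, hj.2.2⟩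
    · intro j hj
      simp only [crossMinusAt, mem_filter, mem_univ, true_and, Equiv.apply_symm_apply] at *
      refine ⟨lt_of_le_of_ne hj.1.2 ?_, hj.1.1, hj.2⟩
      rintro rfl
      simp at hj
    · simp
    · simp
  -- Weak exceedances are recovered from right to left: the flags and the positions beyond `i`
  -- determine which values at least `i` are still free, and the label is the rank of `σ i` among
  -- them.
  have up : ∀ (k : ℕ) (i : Fin n), n ≤ i.1 + k → i ≤ σ i → σ i = τ i := by
    intro k
    induction k with
    | zero => intro i hi; omega
    | succ k ih =>
      intro i hi hw
      have key : ∀ (ρ ρ' : Equiv.Perm (Fin n)), (∀ i, i ≤ ρ i ↔ i ≤ ρ' i) →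
          (∀ i, ρ.symm i ≤ i ↔ ρ'.symm i ≤ i) → (∀ j, i < j → j ≤ ρ j → ρ j = ρ' j) →
          ∀ v, i ≤ v → ρ.symm v ≤ i → ρ'.symm v ≤ i := by
        intro ρ ρ' h1 h2 h3 v hv hρ
        by_contra! hlt
        have h4 : ρ'.symm v ≤ v := (h2 v).1 (hρ.trans hv)
        have h5 : ρ'.symm v ≤ ρ (ρ'.symm v) := (h1 _).2 (by simpa using h4)
        have h6 := h3 _ hlt h5
        rw [Equiv.apply_symm_apply] at h6
        rw [← h6, Equiv.symm_apply_apply] at hρ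
        exact absurd hρ (not_le.2 hlt)
      have hj : ∀ j, i < j → j ≤ σ j → σ j = τ j := fun j hij => ih j (by rw [Fin.lt_def] at hij; omega)
      have hS : (univ.filter fun v => i ≤ v ∧ σ.symm v ≤ i) =
          univ.filter fun v => i ≤ v ∧ τ.symm v ≤ i := by
        refine filter_congr fun v _ => and_congr_right fun hv => ⟨key σ τ hE hV hj v hv,
          key τ σ (fun i => (hE i).symm) (fun i => (hV i).symm) (fun j hij hw => ?_) v hv⟩
        exact (hj j hij ((hE j).2 hw)).symm
      have hc := hA i
      rw [minus_empty σ i hw, minus_empty τ i ((hE i).1 hw), plus_card, plus_card, ← hS] at hc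
      refine eq_of_card_filter_lt_eq (S := univ.filter fun v => i ≤ v ∧ σ.symm v ≤ i) ?_ ?_ hc
      · simpa using hw
      · rw [hS]; simpa using (hE i).1 hw
  -- The other positions are recovered from left to right; the label now counts the larger free
  -- values, hence the order dual.
  have down : ∀ (k : ℕ) (i : Fin n), i.1 < k → σ i < i → σ i = τ i := by
    intro k
    induction k with
    | zero => intro i hi; omega
    | succ k ih =>
      intro i hi hw
      have key : ∀ (ρ ρ' : Equiv.Perm (Fin n)), (∀ i, i ≤ ρ i ↔ i ≤ ρ' i) →
          (∀ i, ρ.symm i ≤ i ↔ ρ'.symm i ≤ i) → (∀ j, j < i → ρ j < j → ρ j = ρ' j) →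
          ∀ v, v < i → i ≤ ρ.symm v → i ≤ ρ'.symm v := by
        intro ρ ρ' h1 h2 h3 v hv hρ
        by_contra! hlt
        have h4 : v < ρ'.symm v := not_le.1 (mt (h2 v).2 (not_le.2 (hv.trans_le hρ)))
        have h5 : ρ (ρ'.symm v) < ρ'.symm v :=
          not_le.1 (mt (h1 _).1 (by simpa using h4))
        have h6 := h3 _ hlt h5
        rw [Equiv.apply_symm_apply] at h6
        rw [← Equiv.eq_symm_apply] at h6
        rw [← h6] at hρ
        exact absurd hρ (not_le.2 hlt)
      have hj : ∀ j, j < i → σ j < j → σ j = τ j := fun j hij => ih j (by rw [Fin.lt_def] at hij; omega)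
      have hE' : ∀ i, σ i < i ↔ τ i < i := fun i => by simpa using not_congr (hE i)
      have hS : (univ.filter fun v : (Fin n)ᵒᵈ => OrderDual.ofDual v < i ∧ i ≤ σ.symm (OrderDual.ofDual v)) =
          univ.filter fun v : (Fin n)ᵒᵈ => OrderDual.ofDual v < i ∧ i ≤ τ.symm (OrderDual.ofDual v) := by
        refine filter_congr fun v _ => and_congr_right fun hv => ⟨key σ τ hE hV hj _ hv,
          key τ σ (fun i => (hE i).symm) (fun i => (hV i).symm) (fun j hij hw => ?_) _ hv⟩
        exact (hj j hij ((hE' j).2 hw)).symm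
      have hc := hA i
      rw [plus_empty σ i hw, plus_empty τ i ((hE' i).1 hw), minus_card, minus_card, ← hS] at hc
      rw [zero_add, zero_add] at hc
      refine OrderDual.toDual.injective (eq_of_card_filter_lt_eq
        (S := univ.filter fun v : (Fin n)ᵒᵈ => OrderDual.ofDual v < i ∧ i ≤ σ.symm (OrderDual.ofDual v)) ?_ ?_ hc)
      · simpa using hw
      · rw [hS]; simpa using (hE' i).1 hw
  ext i
  rcases le_or_gt i (σ i) with h | h
  · rw [up n i (by omega) h]
  · rw [down n i i.2 h]

end PermStat
namespace PermStat

open Finset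

/-! ### Descents and the patterns `13-2` and `2-13` -/

/-- The position `i` is followed by a position, and `π i < v ≤ π (i + 1)`. -/
def Bar {n : ℕ} (π : Equiv.Perm (Fin n)) (v : ℕ) (i : Fin n) : Prop :=
  (π i).1 < v ∧ ∃ h : i.1 + 1 < n, v ≤ (π ⟨i.1 + 1, h⟩).1

/-- The value `v` is preceded by a smaller value. -/
def AscTop {n : ℕ} (π : Equiv.Perm (Fin n)) (v : Fin n) : Prop :=
  ∃ i : Fin n, i.1 + 1 = (π.symm v).1 ∧ π i < v

/-- The value `v` is followed by a larger value. -/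
def AscBot {n : ℕ} (π : Equiv.Perm (Fin n)) (v : Fin n) : Prop :=
  ∃ h : (π.symm v).1 + 1 < n, v < π ⟨(π.symm v).1 + 1, h⟩

/-- The positions `i` of the occurrences of `13-2` in which `v` plays the role of `2`. -/
def left13At {n : ℕ} (π : Equiv.Perm (Fin n)) (v : Fin n) : Finset (Fin n) :=
  univ.filter fun i => i < π.symm v ∧ ∃ h : i.1 + 1 < n, π i < v ∧ v < π ⟨i.1 + 1, h⟩

/-- The positions `i` of the occurrences of `2-13` in which `v` plays the role of `2`. -/
def right13At {n : ℕ} (π : Equiv.Perm (Fin n)) (v : Fin n) : Finset (Fin n) :=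
  univ.filter fun i => π.symm v < i ∧ ∃ h : i.1 + 1 < n, π i < v ∧ v < π ⟨i.1 + 1, h⟩

open Classical in
/-- The number of ascents of `π` over the gap below the value `v`. -/
noncomputable def barHeight {n : ℕ} (π : Equiv.Perm (Fin n)) (v : ℕ) : ℕ :=
  (univ.filter fun i => Bar π v i).card

open Classical in
/-- The pattern history of a permutation. -/
noncomputable def barCode {n : ℕ} (π : Equiv.Perm (Fin n)) (v : Fin n) : Letter :=
  (!decide (AscTop π v), !decide (AscBot π v), (left13At π v).card)

theorem barHeight_zero {n : ℕ} (π : Equiv.Perm (Fin n)) : barHeight π 0 = 0 := by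
  simp [barHeight, Bar]

theorem barHeight_self {n : ℕ} (π : Equiv.Perm (Fin n)) : barHeight π n = 0 := by
  classical
  rw [barHeight, card_eq_zero, filter_eq_empty_iff]
  rintro i - ⟨-, h, h'⟩
  exact absurd (π ⟨i.1 + 1, h⟩).2 (not_lt.2 h')

open Classical in
theorem card_ascTop {n : ℕ} (π : Equiv.Perm (Fin n)) (v : Fin n) :
    (univ.filter fun i : Fin n => i.1 + 1 = (π.symm v).1 ∧ π i < v).card =
      (decide (AscTop π v)).toNat := by
  by_cases h : AscTop π v
  · obtain ⟨i, hi, hi'⟩ := id h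
    simp only [h, decide_true, Bool.toNat_true]
    refine card_eq_one.2 ⟨i, ?_⟩
    ext j
    simp only [mem_filter, mem_univ, true_and, mem_singleton]
    refine ⟨fun hj => Fin.ext (by omega), ?_⟩
    rintro rfl
    exact ⟨hi, hi'⟩
  · simp only [h, decide_false, Bool.toNat_false]
    exact card_eq_zero.2 (filter_eq_empty_iff.2 fun i _ hi => h ⟨i, hi⟩)

theorem val_succ_eq_iff {n : ℕ} (π : Equiv.Perm (Fin n)) (v i : Fin n) (h : i.1 + 1 < n) :
    (π ⟨i.1 + 1, h⟩).1 = v.1 ↔ i.1 + 1 = (π.symm v).1 := by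
  rw [← Fin.ext_iff, ← Equiv.eq_symm_apply, Fin.ext_iff]

theorem barHeight_step {n : ℕ} (π : Equiv.Perm (Fin n)) (v : Fin n) :
    barHeight π (v + 1) + (barCode π v).2.1.toNat = barHeight π v + (barCode π v).1.toNat := by
  classical
  have key : barHeight π (v + 1) + (decide (AscTop π v)).toNat =
      barHeight π v + (decide (AscBot π v)).toNat := by
    rw [← card_ascTop, ← card_filter_eq_and (π.symm v), barHeight, barHeight,
      ← card_union_of_disjoint, ← card_union_of_disjoint]
    · congr 1
      ext i
      simp only [mem_union, mem_filter, mem_univ, true_and]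
      constructor
      · rintro (⟨h, h', h''⟩ | ⟨h, h'⟩)
        · by_cases hi : π i = v
          · right
            subst hi
            simp only [Equiv.symm_apply_apply, AscBot, true_and]
            exact ⟨h', Fin.lt_def.2 (by omega)⟩
          · have := Fin.val_ne_of_ne hi
            exact Or.inl ⟨by omega, h', by omega⟩
        · have h1 : i.1 + 1 < n := h ▸ (π.symm v).2
          exact Or.inl ⟨h', h1, ((val_succ_eq_iff π v i h1).2 h).ge⟩
      · rintro (⟨h, h', h''⟩ | ⟨h, h', h''⟩)
        · by_cases hi : i.1 + 1 = (π.symm v).1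
          · exact Or.inr ⟨hi, h⟩
          · have := mt (val_succ_eq_iff π v i h').1 hi
            exact Or.inl ⟨by omega, h', by omega⟩
        · subst h
          exact Or.inl ⟨by simp, h', h''⟩
    · rw [disjoint_filter]
      rintro i - ⟨h, h', h''⟩ ⟨rfl, -⟩
      simp at h
    · rw [disjoint_filter]
      rintro i - ⟨h, h', h''⟩ ⟨h1, -⟩
      have := (val_succ_eq_iff π v i h').2 h1
      omega
  simp only [barCode]
  by_cases h1 : AscTop π v <;> by_cases h2 : AscBot π v <;> simp [h1, h2] at key ⊢ <;> omega

/-- An ascent over the gap below `v` either ends at `v` or jumps over `v`; in the latter case it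
lies left or right of `v` and forms a `13-2` or a `2-13`. -/
theorem patterns_at {n : ℕ} (π : Equiv.Perm (Fin n)) (v : Fin n) :
    (barCode π v).2.2 + (right13At π v).card + 1 = barHeight π v + (barCode π v).1.toNat := by
  classical
  have key : (left13At π v).card + (right13At π v).card + (decide (AscTop π v)).toNat =
      barHeight π v := by
    rw [← card_ascTop, barHeight, left13At, right13At, ← card_union_of_disjoint,
      ← card_union_of_disjoint]
    · congr 1
      ext i
      simp only [mem_union, mem_filter, mem_univ, true_and]
      constructor
      · rintro ((⟨h, h1, h2, h3⟩ | ⟨h, h1, h2, h3⟩) | ⟨h, h'⟩)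
        · exact ⟨h2, h1, (Fin.lt_def.1 h3).le⟩
        · exact ⟨h2, h1, (Fin.lt_def.1 h3).le⟩
        · have h1 : i.1 + 1 < n := h ▸ (π.symm v).2
          exact ⟨h', h1, ((val_succ_eq_iff π v i h1).2 h).ge⟩
      · rintro ⟨h, h', h''⟩
        by_cases hi : i.1 + 1 = (π.symm v).1
        · exact Or.inr ⟨hi, h⟩
        · have h1 := mt (val_succ_eq_iff π v i h').1 hi
          have h2 : v < π ⟨i.1 + 1, h'⟩ := Fin.lt_def.2 (by omega)
          rcases lt_trichotomy i (π.symm v) with h3 | h3 | h3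
          · exact Or.inl (Or.inl ⟨h3, h', h, h2⟩)
          · rw [h3, Equiv.apply_symm_apply] at h
            exact absurd h (lt_irrefl _)
          · exact Or.inl (Or.inr ⟨h3, h', h, h2⟩)
    · rw [← filter_or, disjoint_filter]
      rintro i - (⟨-, h, -, h2⟩ | ⟨-, h, -, h2⟩) ⟨h1, -⟩ <;>
      · have := (val_succ_eq_iff π v i h).2 h1
        exact absurd this (Fin.lt_def.1 h2).ne'
    · rw [disjoint_filter]
      rintro i - ⟨h, -⟩ ⟨h', -⟩
      exact lt_asymm h h'
  simp only [barCode]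
  by_cases h1 : AscTop π v <;> simp [h1] at key ⊢ <;> omega

theorem barCode_mem {n : ℕ} (π : Equiv.Perm (Fin n)) : word (barCode π) ∈ hist n 0 :=
  word_mem_hist (barHeight_zero π) (barHeight_self π) (barHeight_step π) fun i => by
    have := patterns_at π i
    omega

theorem occ13_2_eq {n : ℕ} (π : Equiv.Perm (Fin n)) :
    occ13_2 π = ∑ v, (barCode π v).2.2 := by
  classical
  rw [← Equiv.sum_comp π, occ13_2, card_eq_sum_card_fiberwise (f := Prod.snd) (t := univ) (by simp)]
  refine sum_congr rfl fun j _ => ?_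
  simp only [barCode, left13At, Equiv.symm_apply_apply]
  refine card_bij' (fun x _ => x.1) (fun i _ => (i, j)) ?_ ?_ ?_ ?_
  · rintro ⟨i, j'⟩ h
    simp only [mem_filter, mem_univ, true_and] at h ⊢
    rw [← h.2]; exact h.1
  · intro i h
    simpa using h
  · rintro ⟨i, j'⟩ h
    simp only [mem_filter, mem_univ, true_and] at h ⊢
    rw [← h.2]
  · intros; rfl

theorem occ2_13_eq {n : ℕ} (π : Equiv.Perm (Fin n)) :
    occ2_13 π = ∑ v, (right13At π v).card := by
  classical
  rw [← Equiv.sum_comp π, occ2_13, card_eq_sum_card_fiberwise (f := Prod.fst) (t := univ) (by simp)]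
  refine sum_congr rfl fun j _ => ?_
  simp only [right13At, Equiv.symm_apply_apply]
  refine card_bij' (fun x _ => x.2) (fun i _ => (j, i)) ?_ ?_ ?_ ?_
  · rintro ⟨i, j'⟩ h
    simp only [mem_filter, mem_univ, true_and] at h ⊢
    rw [← h.2]; exact h.1
  · intro i h
    simpa using h
  · rintro ⟨i, j'⟩ h
    simp only [mem_filter, mem_univ, true_and] at h ⊢
    rw [← h.2]
  · intros; rfl

/-- The values not followed by a larger one sit at the descents and at the last position, whence the
`+ 1`. -/
theorem descents_add_one {n : ℕ} (hn : 1 ≤ n) (π : Equiv.Perm (Fin n)) :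
    descents π + 1 = (univ.filter fun v => (barCode π v).2.1 = true).card := by
  classical
  have hl : n - 1 < n := by omega
  have h1 : (univ.filter fun v => (barCode π v).2.1 = true).card =
      (univ.filter fun i : Fin n => ¬ AscBot π (π i)).card := by
    refine card_bij' (fun j _ => π.symm j) (fun j _ => π j) ?_ ?_ ?_ ?_ <;> simp [barCode]
  rw [h1]
  refine (congrArg (descents π + ·) (card_singleton (⟨n - 1, hl⟩ : Fin n)).symm).trans ?_
  simp only [descents]
  rw [← card_union_of_disjoint]
  · congr 1
    ext i
    simp only [mem_union, mem_filter, mem_univ, true_and, mem_singleton, AscBot,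
      Equiv.symm_apply_apply, not_exists, not_lt, Fin.ext_iff]
    constructor
    · rintro (⟨h, h'⟩ | h)
      · exact fun _ => h'.le
      · intro h'; omega
    · intro h
      by_cases hi : i.1 + 1 < n
      · refine Or.inl ⟨hi, lt_of_le_of_ne (h hi) fun he => ?_⟩
        have := congrArg Fin.val (π.injective he)
        simp at this
      · exact Or.inr (by omega)
  · simp only [disjoint_singleton_right, mem_filter, mem_univ, true_and, not_exists]
    intro h
    omega

/-! ### Recovering a permutation from its pattern history -/

open Classical in
/-- The number of ascents over the gap below `v` that start left of the position `k`. -/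
noncomputable def barsBefore {n : ℕ} (π : Equiv.Perm (Fin n)) (v : ℕ) (k : Fin n) : ℕ :=
  (univ.filter fun w => w < k ∧ Bar π v w).card

theorem barsBefore_eq {n : ℕ} (π : Equiv.Perm (Fin n)) (v : Fin n) :
    barsBefore π v (π.symm v) + (barCode π v).1.toNat = (barCode π v).2.2 + 1 := by
  classical
  have key : barsBefore π v (π.symm v) = (left13At π v).card + (decide (AscTop π v)).toNat := by
    rw [← card_ascTop, barsBefore, left13At, ← card_union_of_disjoint]
    · congr 1
      ext i
      simp only [mem_union, mem_filter, mem_univ, true_and]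
      constructor
      · rintro ⟨h0, h, h', h''⟩
        by_cases hi : i.1 + 1 = (π.symm v).1
        · exact Or.inr ⟨hi, h⟩
        · have h1 := mt (val_succ_eq_iff π v i h').1 hi
          exact Or.inl ⟨h0, h', h, Fin.lt_def.2 (by omega)⟩
      · rintro (⟨h, h1, h2, h3⟩ | ⟨h, h'⟩)
        · exact ⟨h, h2, h1, (Fin.lt_def.1 h3).le⟩
        · have h1 : i.1 + 1 < n := h ▸ (π.symm v).2
          exact ⟨Fin.lt_def.2 (by omega), h', h1, ((val_succ_eq_iff π v i h1).2 h).ge⟩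
    · rw [disjoint_filter]
      rintro i - ⟨-, h, -, h2⟩ ⟨h1, -⟩
      have := (val_succ_eq_iff π v i h).2 h1
      exact absurd this (Fin.lt_def.1 h2).ne'
  rw [key]
  simp only [barCode]
  by_cases h1 : AscTop π v <;> simp [h1]

/-- Among the values below `v`, those to the left of `v` are the ones with few ascents over the
gap below `v` to their left. -/
theorem lt_symm_iff_barsBefore {n : ℕ} (π : Equiv.Perm (Fin n)) (v u : Fin n) (hu : u < v) :
    π.symm u < π.symm v ↔ barsBefore π v (π.symm u) < barsBefore π v (π.symm v) := by
  classical
  constructor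
  · intro h
    -- Take the last position `w` before `v` with a smaller value. The next value is at least `v`,
    -- so `w` starts an ascent counted up to `v` but not up to `u`.
    obtain ⟨w, hw, hmax⟩ := (univ.filter fun w : Fin n => w < π.symm v ∧ π w < v).exists_max_image id
      ⟨π.symm u, by simpa using ⟨h, hu⟩⟩
    simp only [mem_filter, mem_univ, true_and, id] at hw hmax
    have huw : π.symm u ≤ w := hmax _ ⟨h, by simpa using hu⟩
    have hw1 : w.1 + 1 < n := by
      have := Fin.lt_def.1 hw.1
      omega
    have hbar : Bar π v w := by
      refine ⟨hw.2, hw1, ?_⟩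
      by_contra! hlt
      by_cases he : w.1 + 1 = (π.symm v).1
      · have := (val_succ_eq_iff π v w hw1).2 he
        omega
      · have := hmax ⟨w.1 + 1, hw1⟩ ⟨Fin.lt_def.2 (by have := Fin.lt_def.1 hw.1; simp only; omega), hlt⟩
        have := Fin.le_def.1 this
        simp at this
    refine card_lt_card ⟨fun x hx => ?_, fun hs => ?_⟩
    · simp only [mem_filter, mem_univ, true_and] at *
      exact ⟨hx.1.trans h, hx.2⟩
    · have := hs (mem_filter.2 ⟨mem_univ w, hw.1, hbar⟩)
      simp only [mem_filter, mem_univ, true_and] at this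
      exact absurd this.1 (not_lt.2 huw)
  · intro h
    by_contra! hle
    refine absurd h (not_lt.2 (card_le_card fun x hx => ?_))
    simp only [mem_filter, mem_univ, true_and] at *
    exact ⟨hx.1.trans_le hle, hx.2⟩

/-- The value `w < v` is followed by `v` if and only if `v` is preceded by a smaller value and `w`
is the last value below `v` to the left of `v`. -/
theorem symm_succ_iff {n : ℕ} (π : Equiv.Perm (Fin n)) (v w : Fin n) (hw : w < v) :
    (π.symm w).1 + 1 = (π.symm v).1 ↔ AscTop π v ∧ π.symm w < π.symm v ∧
      ∀ u < v, π.symm u < π.symm v → ¬ π.symm w < π.symm u := by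
  constructor
  · intro h
    refine ⟨⟨π.symm w, h, by simpa using hw⟩, Fin.lt_def.2 (by omega), fun u _ h1 h2 => ?_⟩
    rw [Fin.lt_def] at h1 h2
    omega
  · rintro ⟨⟨i, hi, hi'⟩, h1, h2⟩
    have h3 := h2 (π i) hi' (by rw [Equiv.symm_apply_apply, Fin.lt_def]; omega)
    rw [Equiv.symm_apply_apply] at h3
    rw [Fin.lt_def] at h1 h3
    omega

theorem bar_succ_iff {n : ℕ} (π : Equiv.Perm (Fin n)) (v w : Fin n) (hw : w < v) :
    Bar π (v + 1) (π.symm w) ↔ Bar π v (π.symm w) ∧ (π.symm w).1 + 1 ≠ (π.symm v).1 := by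
  simp only [Bar, Equiv.apply_symm_apply]
  rw [Fin.lt_def] at hw
  constructor
  · rintro ⟨-, h, h'⟩
    exact ⟨⟨hw, h, by omega⟩, fun he => by have := (val_succ_eq_iff π v _ h).2 he; omega⟩
  · rintro ⟨⟨-, h, h'⟩, h2⟩
    have := mt (val_succ_eq_iff π v _ h).1 h2
    exact ⟨by omega, h, by omega⟩

theorem bar_succ_self_iff {n : ℕ} (π : Equiv.Perm (Fin n)) (v : Fin n) :
    Bar π (v + 1) (π.symm v) ↔ AscBot π v := by
  simp only [Bar, AscBot, Equiv.apply_symm_apply, Fin.lt_def, Nat.succ_le_iff, Nat.lt_succ_self,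
    true_and]

theorem barsBefore_symm {n : ℕ} (π : Equiv.Perm (Fin n)) (v u : Fin n) [DecidablePred (Bar π v)] :
    barsBefore π v (π.symm u) =
      (univ.filter fun w : Fin n => w < v ∧ π.symm w < π.symm u ∧ Bar π v (π.symm w)).card := by
  classical
  refine card_bij' (fun j _ => π j) (fun j _ => π.symm j) ?_ ?_ ?_ ?_
  · intro j hj
    simp only [mem_filter, mem_univ, true_and, Equiv.symm_apply_apply] at *
    exact ⟨Fin.lt_def.2 hj.2.1, hj⟩
  · intro j hj
    simp only [mem_filter, mem_univ, true_and] at *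
    exact hj.2
  · simp
  · simp

/-- The values are inserted in increasing order: by `barsBefore_eq` and `lt_symm_iff_barsBefore`,
the letter of `v` fixes its place among the smaller values. -/
theorem barCode_injective {n : ℕ} : Function.Injective (barCode (n := n)) := by
  classical
  intro π τ hpt
  have hT : ∀ v, AscTop π v ↔ AscTop τ v := fun v => by
    simpa [barCode] using congrArg Prod.fst (congrFun hpt v)
  have hB : ∀ v, AscBot π v ↔ AscBot τ v := fun v => by
    simpa [barCode] using congrArg (fun x : Letter => x.2.1) (congrFun hpt v)
  -- The invariant also records which values below `k` are followed by one at least `k`, since the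
  -- ascent counts of the next insertion depend on it.
  have main : ∀ k ≤ n, (∀ u w : Fin n, u.1 < k → w.1 < k →
      (π.symm u < π.symm w ↔ τ.symm u < τ.symm w)) ∧
      ∀ u : Fin n, u.1 < k → (Bar π k (π.symm u) ↔ Bar τ k (τ.symm u)) := by
    intro k
    induction k with
    | zero => intro _; simp
    | succ k ih =>
      intro hk
      obtain ⟨ho, hb⟩ := ih (by omega)
      obtain ⟨v, rfl⟩ : ∃ v : Fin n, v.1 = k := ⟨⟨k, hk⟩, rfl⟩
      have hbars : ∀ u < v, barsBefore π v (π.symm u) = barsBefore τ v (τ.symm u) := by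
        intro u hu
        rw [barsBefore_symm, barsBefore_symm]
        congr 1
        refine filter_congr fun w _ => and_congr_right fun hw => ?_
        rw [ho w u hw hu, hb w hw]
      have hself : barsBefore π v (π.symm v) = barsBefore τ v (τ.symm v) := by
        have h1 := barsBefore_eq π v
        have h2 := barsBefore_eq τ v
        rw [hpt] at h1
        omega
      have hlt : ∀ u < v, (π.symm u < π.symm v ↔ τ.symm u < τ.symm v) := fun u hu => by
        rw [lt_symm_iff_barsBefore π v u hu, lt_symm_iff_barsBefore τ v u hu, hbars u hu, hself]
      have hgt : ∀ u < v, (π.symm v < π.symm u ↔ τ.symm v < τ.symm u) := fun u hu => by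
        have h1 : π.symm u ≠ π.symm v := π.symm.injective.ne hu.ne
        have h2 : τ.symm u ≠ τ.symm v := τ.symm.injective.ne hu.ne
        have h3 := not_congr (hlt u hu)
        rw [not_lt, not_lt] at h3
        exact ⟨fun h => lt_of_le_of_ne (h3.1 h.le) h2.symm,
          fun h => lt_of_le_of_ne (h3.2 h.le) h1.symm⟩
      refine ⟨fun u w hu hw => ?_, fun u hu => ?_⟩
      · rcases lt_or_eq_of_le (Nat.lt_succ_iff.1 hu) with hu | hu <;>
          rcases lt_or_eq_of_le (Nat.lt_succ_iff.1 hw) with hw | hw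
        · exact ho u w hu hw
        · rw [Fin.ext hw]; exact hlt u hu
        · rw [Fin.ext hu]; exact hgt w hw
        · rw [Fin.ext hu, Fin.ext hw]; simp
      · rcases lt_or_eq_of_le (Nat.lt_succ_iff.1 hu) with hu | hu
        · rw [bar_succ_iff π v u hu, bar_succ_iff τ v u hu, hb u hu, Ne, Ne,
            symm_succ_iff π v u hu, symm_succ_iff τ v u hu, hT, hlt u hu]
          refine and_congr_right fun _ => not_congr (and_congr_right fun _ =>
            and_congr_right fun _ => forall_congr' fun x => forall_congr' fun hx => ?_)
          rw [hlt x hx, ho u x hu hx]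
        · rw [Fin.ext hu, bar_succ_self_iff, bar_succ_self_iff, hB]
  have hord := (main n le_rfl).1
  have hsymm : ∀ v, π.symm v = τ.symm v := by
    intro v
    have h : ∀ ρ : Equiv.Perm (Fin n), (ρ.symm v).1 =
        (univ.filter fun w : Fin n => ρ.symm w < ρ.symm v).card := by
      intro ρ
      rw [← Fin.card_Iio (ρ.symm v)]
      refine card_bij' (fun j _ => ρ j) (fun j _ => ρ.symm j) ?_ ?_ ?_ ?_ <;> simp
    refine Fin.ext ?_
    rw [h π, h τ]
    congr 1
    exact filter_congr fun w _ => hord w v w.2 v.2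
  rw [← Equiv.symm_symm π, ← Equiv.symm_symm τ, Equiv.ext hsymm]

end PermStat

/-! ### The bijection -/

theorem mainTheorem8 (n : ℕ) (hn : 1 ≤ n) :
    ∃ Φ : Equiv.Perm (Fin n) ≃ Equiv.Perm (Fin n), ∀ k l m : ℕ,
      Set.BijOn Φ
        {σ | PermStat.wex σ = k ∧ PermStat.crossings σ = l ∧ PermStat.nestings σ = m}
        {π | (PermStat.descents π : ℤ) = (k : ℤ) - 1 ∧
          PermStat.occ13_2 π = l ∧ PermStat.occ2_13 π = m} := by
  obtain ⟨Φ, hΦ⟩ := PermStat.exists_equiv_of_injective PermStat.arcCode_injective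
    PermStat.barCode_injective PermStat.arcCode_mem (PermStat.barCode_mem (n := n))
  have hdes : ∀ σ, PermStat.descents (Φ σ) + 1 = PermStat.wex σ := fun σ => by
    rw [PermStat.descents_add_one hn, PermStat.wex_eq, hΦ]
  have hocc : ∀ σ, PermStat.occ13_2 (Φ σ) = PermStat.crossings σ := fun σ => by
    rw [PermStat.occ13_2_eq, PermStat.crossings, hΦ, ← Finset.sum_add_distrib]
    rfl
  have hocc' : ∀ σ, PermStat.occ2_13 (Φ σ) = PermStat.nestings σ := fun σ => by
    rw [PermStat.occ2_13_eq, PermStat.nestings, ← Finset.sum_add_distrib]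
    refine Finset.sum_congr rfl fun v _ => ?_
    have hH := PermStat.height_unique (PermStat.arcHeight_zero σ) (PermStat.barHeight_zero (Φ σ))
      (PermStat.arcHeight_step σ) (fun i => by rw [← hΦ]; exact PermStat.barHeight_step (Φ σ) i)
      v v.2.le
    have h1 := PermStat.crossings_nestings_at σ v
    have h2 := PermStat.patterns_at (Φ σ) v
    rw [hΦ] at h2
    omega
  refine ⟨Φ, fun k l m => ⟨?_, Φ.injective.injOn, ?_⟩⟩
  · rintro σ ⟨h1, h2, h3⟩
    have := hdes σ
    exact ⟨by omega, (hocc σ).trans h2, (hocc' σ).trans h3⟩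
  · rintro π ⟨h1, h2, h3⟩
    have h0 := hdes (Φ.symm π)
    have h4 := hocc (Φ.symm π)
    have h5 := hocc' (Φ.symm π)
    rw [Equiv.apply_symm_apply] at h0 h4 h5
    exact ⟨Φ.symm π, ⟨by omega, h4.symm.trans h2, h5.symm.trans h3⟩, Φ.apply_symm_apply π⟩
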